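/- Let $\Lambda$ be a finite metric space that is a (region of a) $D$-dimensional lattice, in the sense that every ball of radius $\rho\ge 0$ contains at most $G(1+\rho)^D$ sites. Place a $q$-level particle on each site and let $H=\sum_{X\subseteq\Lambda}H_X$ be a local Hamiltonian: each $H_X$ is self-adjoint, acts only on the sites of $X$, satisfies $\|H_X\|\le E$, and vanishes unless $X$ consists of at most $k$ sites with mutual distances at most $r$. Write $A(t)=e^{iHt}Ae^{-iHt}$, so that $A(0)=A$. Norms are operator norms. If $A$ acts on a set $S$ of $V=|S|\ge 1$ sites and $d$ is a real number, let $R=R(d)$ be the ball of radius $d$ around $S$, i.e. the set of sites at distance at most $d$ from $S$, and let $H_R=\sum_{X\subseteq R}H_X$. For all $D,G,k,r,E$ there are constants $c,v,\xi,c'>0$, depending only on $D,G,k,r,E$ (in particular independent of the system size $|\Lambda|$, of $q$, and of the observable), such that: (a) $c,v,\xi$ are Lieb–Robinson constants: for all such systems, all $A$ acting on a set $S$ and $B$ acting on a set $T$, all real $d$ with $\operatorname{dist}(x,y)\ge d$ for every $x\in S$, $y\in T$, and all $t\ge 0$, $$\|[B,A(t)]\|\le c\,|S|\,\|A\|\,\|B\|\,e^{-(d-vt)/\xi};$$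 (b) $c'$ is a second-order remainder constant: for all self-adjoint $K$ and all operators $A$ on a finite-dimensional Hilbert space and all real $t$, $$\|e^{iKt}Ae^{-iKt}-A-it[K,A]\|\le c'\|A\|\|K\|^2t^2;$$ (c) for every $V_0$ there is a constant $\kappa>0$, depending only on $V_0$ and on $D,G,k,r,E$ (and the choice of $c,v,\xi,c'$), such that for all such systems, every $A$ acting on a nonempty set $S$ of $V\le V_0$ sites, every $t>0$ and every radius $d\ge vt+\log\frac{cV}{c't}$ (in particular for $d$ equal to this number), $$\|A(t)-A(0)-it[H_R,A]\|\le\kappa\,\|A\|\left(vt+\log\frac{cV}{c't}\right)^{2}t^2;$$ (d) there is a constant $\kappa>0$, depending only on $D,G,k,r,E$ (and the choice of $c,v,\xi,c'$) and not on $V$, such that for all such systems, every $A$ acting on a nonempty set $S$ of $V$ sites, every $t>0$ such that $S$ has diameter at most $vt+\log\frac{cV}{c't}$, and every radius $d\ge vt+\log\frac{cV}{c't}$, $$\|A(t)-A(0)-it[H_R,A]\|\le\kappa\,\|A\|\left(vt+\log\frac{cV}{c't}\right)^{2D}t^2 .$$ -/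

import Mathlib

open scoped Matrix.Norms.L2Operator

noncomputable section

namespace LocalHam

/-- Operators on a finite-dimensional Hilbert space with orthonormal basis indexed by `ι`, as
matrices. The norm in scope is the operator norm induced by the Euclidean norm. -/
abbrev Op (ι : Type) : Type := Matrix ι ι ℂ

/-- Basis configurations of a system with one `q`-level particle on each site of `Λ`; the Hilbert
space `⨂_{x ∈ Λ} ℂ^q` has these as its orthonormal product basis. -/
abbrev Config (Λ : Type) (q : ℕ) : Type := Λ → Fin q

/-- Heisenberg evolution `A(t) = e^{iHt} A e^{-iHt}`. -/
def evolve {ι : Type} [Fintype ι] [DecidableEq ι] (H A : Op ι) (t : ℝ) : Op ι :=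
  NormedSpace.exp ((Complex.I * (t : ℂ)) • H) * A *
    NormedSpace.exp (-(Complex.I * (t : ℂ)) • H)

open Classical in
/-- `A` acts only on the sites in `S`: `A = M ⊗ 1` for an operator `M` of the particles in `S`,
with the identity on all other particles. -/
def SupportedOn {Λ : Type} {q : ℕ} (S : Finset Λ) (A : Op (Config Λ q)) : Prop :=
  ∃ M : Op (S → Fin q), ∀ a b : Config Λ q,
    A a b = if ∀ x, x ∉ S → a x = b x then M (fun x => a x) (fun x => b x) else 0

/-- The finite system of sites `Λ` is (at most) `D`-dimensional with growth constant `G`: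
a ball of radius `ρ` has at most `G (1 + ρ)^D` sites. -/
def IsLattice (D : ℕ) (G : ℝ) (Λ : Type) [MetricSpace Λ] : Prop :=
  ∀ (x : Λ) (ρ : ℝ), 0 ≤ ρ → (Set.ncard {y : Λ | dist x y ≤ ρ} : ℝ) ≤ G * (1 + ρ) ^ D

/-- The family `h` of interaction terms `h X`, indexed by sets `X` of sites, is local: each
`h X` is self-adjoint, acts on `X`, has norm at most `E`, and vanishes unless `X` consists of at
most `k` sites whose mutual distances are at most `r`. -/
structure IsLocal {Λ : Type} [Fintype Λ] [DecidableEq Λ] [MetricSpace Λ] {q : ℕ}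
    (k : ℕ) (r E : ℝ) (h : Finset Λ → Op (Config Λ q)) : Prop where
  isHermitian : ∀ X, (h X).IsHermitian
  supportedOn : ∀ X, SupportedOn X (h X)
  norm_le : ∀ X, ‖h X‖ ≤ E
  card_le : ∀ X, h X ≠ 0 → X.card ≤ k
  dist_le : ∀ X, h X ≠ 0 → ∀ x ∈ X, ∀ y ∈ X, dist x y ≤ r

/-- The part of the Hamiltonian inside the region `R`: all terms acting within `R`. -/
def hamOn {Λ : Type} [DecidableEq Λ] {q : ℕ}
    (h : Finset Λ → Op (Config Λ q)) (R : Finset Λ) : Op (Config Λ q) :=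
  ∑ X ∈ R.powerset, h X

/-- The full Hamiltonian `H = ∑_X h X`. -/
def ham {Λ : Type} [Fintype Λ] [DecidableEq Λ] {q : ℕ}
    (h : Finset Λ → Op (Config Λ q)) : Op (Config Λ q) :=
  ∑ X : Finset Λ, h X

open Classical in
/-- The ball of radius `d` around the set `S`. -/
def ballAround {Λ : Type} [Fintype Λ] [MetricSpace Λ] (S : Finset Λ) (d : ℝ) : Finset Λ :=
  Finset.univ.filter fun x => ∃ y ∈ S, dist x y ≤ d

/-- `c`, `v`, `ξ` are Lieb-Robinson constants for all local Hamiltonians with the given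
microscopic data: `‖[B, A(t)]‖ ≤ c |S| ‖A‖ ‖B‖ e^{-(d - v t)/ξ}` whenever `A` acts on `S` and `B`
acts at distance at least `d` from `S`. -/
def LiebRobinson (D : ℕ) (G : ℝ) (k : ℕ) (r E c v ξ : ℝ) : Prop :=
  ∀ (Λ : Type) [Fintype Λ] [DecidableEq Λ] [MetricSpace Λ], IsLattice D G Λ →
  ∀ (q : ℕ) (h : Finset Λ → Op (Config Λ q)), IsLocal k r E h →
  ∀ (S T : Finset Λ) (A B : Op (Config Λ q)), SupportedOn S A → SupportedOn T B →
  ∀ d : ℝ, (∀ x ∈ S, ∀ y ∈ T, d ≤ dist x y) →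
  ∀ t : ℝ, 0 ≤ t →
    ‖⁅B, evolve (ham h) A t⁆‖ ≤
      c * (S.card : ℝ) * ‖A‖ * ‖B‖ * Real.exp (-((d - v * t) / ξ))

/-- `c'` is a constant for the second-order remainder of the evolution:
`‖e^{iKt} A e^{-iKt} - A - it[K, A]‖ ≤ c' ‖A‖ ‖K‖² t²`. -/
def TaylorConstant (c' : ℝ) : Prop :=
  ∀ (ι : Type) [Fintype ι] [DecidableEq ι] (K A : Op ι), K.IsHermitian → ∀ t : ℝ,
    ‖evolve K A t - A - (Complex.I * (t : ℂ)) • ⁅K, A⁆‖ ≤ c' * ‖A‖ * ‖K‖ ^ 2 * t ^ 2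

/-- The radius `v t + log (c V / (c' t))` for an observable acting on `V` sites. -/
def radius (c v c' : ℝ) (V : ℕ) (t : ℝ) : ℝ :=
  v * t + Real.log (c * (V : ℝ) / (c' * t))

/-- The linearization error `‖A(t) - A(0) - it[H_R, A]‖` for the full evolution under `H` and the
ball `R` of radius `d` around `S`. -/
def linearizationError {Λ : Type} [Fintype Λ] [DecidableEq Λ] [MetricSpace Λ] {q : ℕ}
    (h : Finset Λ → Op (Config Λ q)) (S : Finset Λ) (A : Op (Config Λ q)) (d t : ℝ) : ℝ :=
  ‖evolve (ham h) A t - A - (Complex.I * (t : ℂ)) • ⁅hamOn h (ballAround S d), A⁆‖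

end LocalHam

end

/-! The linearization bounds (c) and (d) need no Lieb–Robinson estimate. The prefactor `c` may be
enlarged until the radius is always at least `max 1 r`. Then the ball contains every interaction
term meeting `S`, so `[H_R, A] = [H, A]` exactly (`lie_hamOn_ballAround`), and second-order Taylor
for the full flow (`norm_flow_taylor`) leaves `‖[H,[H,A]]‖ t²`. By locality this double commutator
is `O(V² E² ‖A‖)`, uniformly in the system size (`norm_lie_ham_lie_ham_le`). For (c), `V ≤ V₀` and
the radius is at least 1; for (d), the growth bound gives `V = O(radius^D)`.

The Lieb–Robinson bound (a) comes from Grönwall applied to all commutators `[h X, B(-t)]` at once,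
weighted by `e^{distance to T}` (`norm_lie_term_flow_le`); one more integration treats a general
`A`. Part (b) is the Taylor bound with `‖[K,[K,A]]‖ ≤ 4 ‖K‖² ‖A‖`. -/

namespace CStarFlow

/-! ### Heisenberg flows on a C⋆-algebra. -/

open Complex

variable {𝔸 : Type*} [CStarAlgebra 𝔸]

/-- The one-parameter automorphism group `A ↦ e^{iHt} A e^{-iHt}` of a C⋆-algebra. -/
noncomputable def flow (H A : 𝔸) (t : ℝ) : 𝔸 :=
  NormedSpace.exp ((I * (t : ℂ)) • H) * A * NormedSpace.exp (-(I * (t : ℂ)) • H)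

theorem exp_mul_exp_neg (H : 𝔸) (z : ℂ) :
    NormedSpace.exp (z • H) * NormedSpace.exp (-z • H) = 1 := by
  have h : Commute (z • H) (-z • H) := ((Commute.refl H).smul_left z).smul_right (-z)
  let _ : NormedAlgebra ℚ 𝔸 := NormedAlgebra.restrictScalars ℚ ℂ 𝔸
  rw [← NormedSpace.exp_add_of_commute h, neg_smul, add_neg_cancel, NormedSpace.exp_zero]

theorem exp_neg_mul_exp (H : 𝔸) (z : ℂ) :
    NormedSpace.exp (-z • H) * NormedSpace.exp (z • H) = 1 := by
  simpa using exp_mul_exp_neg H (-z)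

theorem exp_mem_unitary {H : 𝔸} (hH : IsSelfAdjoint H) (t : ℝ) :
    NormedSpace.exp ((I * (t : ℂ)) • H) ∈ unitary 𝔸 := by
  have hs : star (NormedSpace.exp ((I * (t : ℂ)) • H)) = NormedSpace.exp (-(I * (t : ℂ)) • H) := by
    rw [NormedSpace.star_exp, star_smul, hH.star_eq]
    congr 2
    simp
  rw [Unitary.mem_iff, hs]
  exact ⟨exp_neg_mul_exp H _, exp_mul_exp_neg H _⟩

theorem norm_flow {H : 𝔸} (hH : IsSelfAdjoint H) (A : 𝔸) (t : ℝ) : ‖flow H A t‖ = ‖A‖ := by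
  have h : NormedSpace.exp (-(I * (t : ℂ)) • H) ∈ unitary 𝔸 := by
    simpa using exp_mem_unitary hH (-t)
  rw [flow, CStarRing.norm_mul_mem_unitary _ h,
    CStarRing.norm_mem_unitary_mul _ (exp_mem_unitary hH t)]

@[simp] theorem flow_zero (H A : 𝔸) : flow H A 0 = A := by simp [flow]

theorem flow_neg_neg (H A : 𝔸) (t : ℝ) : flow (-H) A (-t) = flow H A t := by
  simp [flow]

theorem flow_sub (H A B : 𝔸) (t : ℝ) : flow H (A - B) t = flow H A t - flow H B t := by
  simp only [flow]; noncomm_ring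

theorem flow_mul (H A B : 𝔸) (t : ℝ) : flow H (A * B) t = flow H A t * flow H B t := by
  have := exp_neg_mul_exp H (I * (t : ℂ))
  calc flow H (A * B) t = NormedSpace.exp ((I * (t : ℂ)) • H) * A * 1 * B *
        NormedSpace.exp (-(I * (t : ℂ)) • H) := by rw [flow]; noncomm_ring
    _ = _ := by rw [← this, flow, flow]; simp only [mul_assoc]

theorem flow_lie (H A B : 𝔸) (t : ℝ) : flow H ⁅A, B⁆ t = ⁅flow H A t, flow H B t⁆ := by
  simp only [Ring.lie_def, flow_sub, flow_mul]

theorem flow_flow_neg (H A : 𝔸) (t : ℝ) : flow H (flow H A (-t)) t = A := by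
  have h := exp_mul_exp_neg H (I * (t : ℂ))
  simp only [flow, ofReal_neg, mul_neg, neg_neg]
  calc _ = (NormedSpace.exp ((I * (t : ℂ)) • H) * NormedSpace.exp (-(I * (t : ℂ)) • H)) * A *
        (NormedSpace.exp ((I * (t : ℂ)) • H) * NormedSpace.exp (-(I * (t : ℂ)) • H)) := by
        simp only [mul_assoc]
    _ = A := by rw [h]; simp

/-- The flow is an isometric automorphism, so the evolution can be moved from one entry to the other
by running time backwards. -/
theorem norm_lie_flow {H : 𝔸} (hH : IsSelfAdjoint H) (A B : 𝔸) (t : ℝ) :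
    ‖⁅B, flow H A t⁆‖ = ‖⁅A, flow H B (-t)⁆‖ := by
  rw [← norm_flow hH ⁅A, flow H B (-t)⁆ t, flow_lie, flow_flow_neg, Ring.lie_def,
    Ring.lie_def, norm_sub_rev]

/-- Derivative of the flow of a moving element. -/
theorem hasDerivAt_flow_comp (H : 𝔸) {P : ℝ → 𝔸} {P' : 𝔸} {t : ℝ} (hP : HasDerivAt P P' t) :
    HasDerivAt (fun s => flow H (P s) s) (flow H (I • ⁅H, P t⁆ + P') t) t := by
  have h1 : HasDerivAt (fun s : ℝ => NormedSpace.exp ((I * (s : ℂ)) • H))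
      (NormedSpace.exp ((I * (t : ℂ)) • H) * (I • H)) t := by
    have := hasDerivAt_exp_smul_const (𝕂 := ℝ) (I • H) t
    have e : ∀ s : ℝ, s • I • H = (I * (s : ℂ)) • H := fun s => by
      rw [mul_comm, mul_smul, Complex.coe_smul]
    simpa only [e] using this
  have h2 : HasDerivAt (fun s : ℝ => NormedSpace.exp (-(I * (s : ℂ)) • H))
      (-(I • H) * NormedSpace.exp (-(I * (t : ℂ)) • H)) t := by
    have := hasDerivAt_exp_smul_const' (𝕂 := ℝ) (-(I • H)) t
    have e : ∀ s : ℝ, s • -(I • H) = (-(I * (s : ℂ))) • H := fun s => by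
      rw [smul_neg, neg_smul, mul_comm, mul_smul, Complex.coe_smul]
    simpa only [e] using this
  refine ((h1.mul hP).mul h2).congr_deriv ?_
  simp only [flow, Ring.lie_def, smul_sub, Pi.mul_apply]
  simp only [mul_add, add_mul, mul_sub, sub_mul, smul_mul_assoc, mul_smul_comm, mul_assoc, neg_mul,
    mul_neg]
  abel

theorem hasDerivAt_flow (H A : 𝔸) (t : ℝ) :
    HasDerivAt (flow H A) (flow H (I • ⁅H, A⁆) t) t := by
  simpa using hasDerivAt_flow_comp H (hasDerivAt_const t A)

theorem flow_smul (H A : 𝔸) (z : ℂ) (t : ℝ) : flow H (z • A) t = z • flow H A t := by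
  simp [flow]

theorem flow_self (H : 𝔸) (t : ℝ) : flow H H t = H := by
  have h : Commute H (NormedSpace.exp (-(I * (t : ℂ)) • H)) :=
    ((Commute.refl H).smul_right _).exp_right
  rw [flow, mul_assoc, h.eq, ← mul_assoc, exp_mul_exp_neg, one_mul]

theorem hasDerivAt_flow' (H A : 𝔸) (t : ℝ) :
    HasDerivAt (flow H A) (I • ⁅H, flow H A t⁆) t := by
  simpa [flow_smul, flow_lie, flow_self] using hasDerivAt_flow H A t

theorem norm_lie_le (A B : 𝔸) : ‖⁅A, B⁆‖ ≤ 2 * ‖A‖ * ‖B‖ := by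
  rw [Ring.lie_def]
  refine (norm_sub_le _ _).trans ?_
  have := norm_mul_le A B
  have := norm_mul_le B A
  linarith

theorem norm_flow_sub_le {H : 𝔸} (hH : IsSelfAdjoint H) (A : 𝔸) {t : ℝ} (ht : 0 ≤ t) :
    ‖flow H A t - A‖ ≤ ‖⁅H, A⁆‖ * t := by
  have hd : ∀ s, HasDerivAt (fun s => flow H A s - A) (flow H (I • ⁅H, A⁆) s) s := fun s =>
    (hasDerivAt_flow H A s).sub_const A
  refine image_norm_le_of_norm_deriv_right_le_deriv_boundary (a := 0) (b := t)
    (B := fun s => ‖⁅H, A⁆‖ * s) (B' := fun _ => ‖⁅H, A⁆‖)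
    (fun s _ => (hd s).continuousAt.continuousWithinAt) (fun s _ => (hd s).hasDerivWithinAt)
    (by simp) (fun s => by simpa using (hasDerivAt_id s).const_mul ‖⁅H, A⁆‖) (fun s _ => ?_)
    ⟨ht, le_rfl⟩
  rw [norm_flow hH, norm_smul]; simp

theorem norm_flow_taylor_of_nonneg {H : 𝔸} (hH : IsSelfAdjoint H) (A : 𝔸) {t : ℝ} (ht : 0 ≤ t) :
    ‖flow H A t - A - (I * (t : ℂ)) • ⁅H, A⁆‖ ≤ ‖⁅H, ⁅H, A⁆⁆‖ * t ^ 2 := by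
  have hd : ∀ s : ℝ, HasDerivAt (fun s : ℝ => flow H A s - A - (I * (s : ℂ)) • ⁅H, A⁆)
      (flow H (I • ⁅H, A⁆) s - I • ⁅H, A⁆) s := fun s => by
    refine ((hasDerivAt_flow H A s).sub_const A).sub ?_
    have h1 : HasDerivAt (fun s : ℝ => I * (s : ℂ)) I s := by
      simpa using (Complex.ofRealCLM.hasDerivAt (x := s)).const_mul I
    exact h1.smul_const _
  refine image_norm_le_of_norm_deriv_right_le_deriv_boundary (a := 0) (b := t)
    (B := fun s => ‖⁅H, ⁅H, A⁆⁆‖ * s ^ 2) (B' := fun s => ‖⁅H, ⁅H, A⁆⁆‖ * (2 * s))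
    (fun s _ => (hd s).continuousAt.continuousWithinAt) (fun s _ => (hd s).hasDerivWithinAt)
    (by simp) (fun s => by simpa using (hasDerivAt_pow 2 s).const_mul ‖⁅H, ⁅H, A⁆⁆‖)
    (fun s hs => ?_) ⟨ht, le_rfl⟩
  rw [flow_smul, ← smul_sub, norm_smul, norm_I, one_mul]
  refine (norm_flow_sub_le hH _ hs.1).trans ?_
  have := mul_nonneg (norm_nonneg ⁅H, ⁅H, A⁆⁆) hs.1
  linarith

/-- Second-order Taylor estimate for the flow. -/
theorem norm_flow_taylor {H : 𝔸} (hH : IsSelfAdjoint H) (A : 𝔸) (t : ℝ) :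
    ‖flow H A t - A - (I * (t : ℂ)) • ⁅H, A⁆‖ ≤ ‖⁅H, ⁅H, A⁆⁆‖ * t ^ 2 := by
  rcases le_total 0 t with ht | ht
  · exact norm_flow_taylor_of_nonneg hH A ht
  · have h : ∀ B : 𝔸, ⁅-H, B⁆ = -⁅H, B⁆ := fun B => by simp [Ring.lie_def, neg_add_eq_sub]
    have h' : ∀ B : 𝔸, ⁅H, -B⁆ = -⁅H, B⁆ := fun B => by simp [Ring.lie_def, neg_add_eq_sub]
    simpa [flow_neg_neg, h, h'] using norm_flow_taylor_of_nonneg hH.neg A (neg_nonneg.2 ht)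

/-- Jacobi identity with `[F, A] = 0`. It removes `F` from the derivative in the interaction
picture, leaving only `H - F`. -/
theorem lie_lie_comm_of_commute {F A : 𝔸} (h : Commute F A) (B : 𝔸) :
    ⁅F, ⁅A, B⁆⁆ = ⁅A, ⁅F, B⁆⁆ := by
  simp only [Ring.lie_def, mul_sub, sub_mul]
  have h1 : F * (A * B) = A * (F * B) := by rw [← mul_assoc, h.eq, mul_assoc]
  have h2 : B * A * F = B * F * A := by rw [mul_assoc, ← h.eq, mul_assoc]
  rw [h1, h2, mul_assoc A, mul_assoc B, mul_assoc F]
  abel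

/-- The commutator of `A` with the backward flow of `B`, in the interaction picture of a part `F`
of the generator that commutes with `A`. -/
theorem hasDerivAt_interaction {H F A : 𝔸} (hFA : Commute F A) (B : 𝔸) (t : ℝ) :
    HasDerivAt (fun s => flow F ⁅A, flow H B (-s)⁆ s)
      (flow F (-(I • ⁅A, ⁅H - F, flow H B (-t)⁆⁆)) t) t := by
  have h1 : HasDerivAt (fun s : ℝ => flow H B (-s)) (-(I • ⁅H, flow H B (-t)⁆)) t := by
    have := (hasDerivAt_flow' H B (-t)).scomp t (hasDerivAt_neg t)
    simpa [Function.comp_def] using this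
  have h2 : HasDerivAt (fun s : ℝ => ⁅A, flow H B (-s)⁆) ⁅A, -(I • ⁅H, flow H B (-t)⁆)⁆ t := by
    simp only [Ring.lie_def]
    exact (h1.const_mul A).sub (h1.mul_const A)
  refine (hasDerivAt_flow_comp F h2).congr_deriv ?_
  congr 1
  rw [lie_lie_comm_of_commute hFA]
  simp only [Ring.lie_def, mul_sub, sub_mul, mul_neg, neg_mul, smul_sub, mul_smul_comm,
    smul_mul_assoc]
  abel

end CStarFlow

namespace LocalHam

open CStarFlow

theorem evolve_eq_flow {ι : Type} [Fintype ι] [DecidableEq ι] (H A : Op ι) (t : ℝ) :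
    evolve H A t = flow H A t := rfl

theorem taylorConstant_four : TaylorConstant 4 := by
  intro ι _ _ K A hK t
  rw [evolve_eq_flow]
  refine (norm_flow_taylor hK A t).trans ?_
  have h1 := norm_lie_le K ⁅K, A⁆
  have h2 := mul_le_mul_of_nonneg_left (norm_lie_le K A) (norm_nonneg K)
  exact mul_le_mul_of_nonneg_right (by nlinarith) (sq_nonneg t)

/-! ### Operators acting on disjoint regions commute. -/

section Support

variable {Λ : Type} {q : ℕ}

theorem SupportedOn.mul_apply [Fintype Λ] [DecidableEq Λ] {S T : Finset Λ} (hST : Disjoint S T)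
    {A B : Op (Config Λ q)} {M : Op (S → Fin q)} {N : Op (T → Fin q)}
    (hA : ∀ a b : Config Λ q, A a b = @ite ℂ (∀ x, x ∉ S → a x = b x) (Classical.propDecidable _)
      (M (fun x => a x) (fun x => b x)) 0)
    (hB : ∀ a b : Config Λ q, B a b = @ite ℂ (∀ x, x ∉ T → a x = b x) (Classical.propDecidable _)
      (N (fun x => a x) (fun x => b x)) 0)
    (a b : Config Λ q) :
    (A * B) a b = @ite ℂ (∀ x, x ∉ S → x ∉ T → a x = b x) (Classical.propDecidable _)
      (M (fun x => a x) (fun x => b x) * N (fun x => a x) (fun x => b x)) 0 := by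
  classical
  have hd : ∀ x, x ∈ S → x ∉ T := fun x hx => Finset.disjoint_left.1 hST hx
  -- `A` changes only `S` and `B` only `T`, so the sole contributing intermediate configuration has
  -- already reached `b` on `S` and is still `a` elsewhere.
  rw [Matrix.mul_apply, Finset.sum_eq_single (fun x => if x ∈ S then b x else a x)]
  · have h1 : ∀ x, x ∉ S → a x = if x ∈ S then b x else a x := fun x hx => by simp [hx]
    rw [hA, hB, if_pos h1]
    have e1 : (fun x : S => if (x : Λ) ∈ S then b x else a x) = fun x : S => b x := by
      ext x; simp
    have e2 : (fun x : T => if (x : Λ) ∈ S then b x else a x) = fun x : T => a x := by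
      funext x
      exact if_neg fun h => hd x.1 h x.2
    rw [e1, e2]
    by_cases h : ∀ x, x ∉ S → x ∉ T → a x = b x
    · rw [if_pos h, if_pos]
      intro x hx
      by_cases hS : x ∈ S
      · simp [hS]
      · simpa [hS] using h x hS hx
    · rw [if_neg h, if_neg, mul_zero]
      intro h'
      exact h fun x hS hT => by simpa [hS] using h' x hT
  · intro c _ hc
    rw [hA, hB]
    by_cases h1 : ∀ x, x ∉ S → a x = c x
    · rw [if_neg (c := ∀ x, x ∉ T → c x = b x), mul_zero]
      intro h2
      refine hc (funext fun x => ?_)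
      by_cases hS : x ∈ S
      · simp [hS, h2 x (hd x hS)]
      · simp [hS, h1 x hS]
    · rw [if_neg h1, zero_mul]
  · simp

theorem SupportedOn.commute [Fintype Λ] [DecidableEq Λ] {S T : Finset Λ} (hST : Disjoint S T)
    {A B : Op (Config Λ q)} (hA : SupportedOn S A) (hB : SupportedOn T B) : Commute A B := by
  classical
  obtain ⟨M, hM⟩ := hA
  obtain ⟨N, hN⟩ := hB
  ext a b
  rw [mul_apply hST hM hN, mul_apply hST.symm hN hM, mul_comm]
  by_cases h : ∀ x, x ∉ S → x ∉ T → a x = b x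
  · rw [if_pos h, if_pos fun x hT hS => h x hS hT]
  · rw [if_neg h, if_neg fun h' => h fun x hS hT => h' x hT hS]

theorem supportedOn_univ [Fintype Λ] (A : Op (Config Λ q)) : SupportedOn Finset.univ A :=
  ⟨fun a b => A (fun x => a ⟨x, Finset.mem_univ x⟩) (fun x => b ⟨x, Finset.mem_univ x⟩),
    fun a b => by simp⟩

theorem SupportedOn.lie_eq_zero_of_empty [Fintype Λ] [DecidableEq Λ] {A : Op (Config Λ q)}
    (hA : SupportedOn ∅ A) (B : Op (Config Λ q)) : ⁅A, B⁆ = 0 :=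
  (hA.commute (Finset.disjoint_empty_left _) (supportedOn_univ B)).lie_eq

end Support

theorem card_ball_le {Λ : Type} [Fintype Λ] [MetricSpace Λ] {D : ℕ} {G : ℝ} (hΛ : IsLattice D G Λ) (x : Λ) {ρ : ℝ}
    (hρ : 0 ≤ ρ) : ((ballAround {x} ρ).card : ℝ) ≤ G * (1 + ρ) ^ D := by
  refine le_trans (le_of_eq ?_) (hΛ x ρ hρ)
  rw [← Set.ncard_coe_finset]
  congr 2
  ext y
  simp [ballAround, dist_comm]

/-! ### Commutators with a local Hamiltonian and the linearization error. -/

section Interaction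

variable {Λ : Type} [Fintype Λ] [DecidableEq Λ] {q : ℕ}

open Classical in
/-- The sets carrying a nonzero interaction term that meet `S`. -/
noncomputable def termsMeeting (h : Finset Λ → Op (Config Λ q)) (S : Finset Λ) :
    Finset (Finset Λ) :=
  Finset.univ.filter fun X => h X ≠ 0 ∧ ¬Disjoint X S

/-- A bound on the number of interaction terms acting on a given site. -/
noncomputable def termBound (D : ℕ) (G r : ℝ) : ℕ := 2 ^ ⌊G * (1 + max r 0) ^ D⌋₊

theorem lie_sum_left {𝔸 ι : Type*} [NonUnitalNonAssocRing 𝔸] (s : Finset ι) (f : ι → 𝔸) (A : 𝔸) :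
    ⁅∑ i ∈ s, f i, A⁆ = ∑ i ∈ s, ⁅f i, A⁆ := by
  simp only [Ring.lie_def, Finset.sum_mul, Finset.mul_sum, Finset.sum_sub_distrib]

theorem lie_sum_right {𝔸 ι : Type*} [NonUnitalNonAssocRing 𝔸] (s : Finset ι) (f : ι → 𝔸) (A : 𝔸) :
    ⁅A, ∑ i ∈ s, f i⁆ = ∑ i ∈ s, ⁅A, f i⁆ := by
  simp only [Ring.lie_def, Finset.sum_mul, Finset.mul_sum, Finset.sum_sub_distrib]

section

variable {h : Finset Λ → Op (Config Λ q)}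

/-- Assuming commutation instead of support lets this apply to `[h X, A]` with region `S ∪ X`,
without proving that commutators are supported there. -/
theorem lie_ham_eq_sum (S : Finset Λ) (A : Op (Config Λ q))
    (hA : ∀ X, Disjoint X S → Commute (h X) A) :
    ⁅ham h, A⁆ = ∑ X ∈ termsMeeting h S, ⁅h X, A⁆ := by
  rw [ham, lie_sum_left]
  refine (Finset.sum_subset (Finset.subset_univ _) fun X _ hX => ?_).symm
  by_cases h0 : h X = 0
  · simp [h0, Ring.lie_def]
  · exact (hA X (by simpa [termsMeeting, h0] using hX)).lie_eq

theorem commute_ham_sub_sum (S : Finset Λ) (A : Op (Config Λ q))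
    (hA : ∀ X, Disjoint X S → Commute (h X) A) :
    Commute (ham h - ∑ X ∈ termsMeeting h S, h X) A := by
  rw [commute_iff_lie_eq]
  have e : ∀ B C : Op (Config Λ q), ⁅B - C, A⁆ = ⁅B, A⁆ - ⁅C, A⁆ := fun B C => by
    simp only [Ring.lie_def]; noncomm_ring
  rw [e, lie_ham_eq_sum S A hA, lie_sum_left, sub_self]

variable [MetricSpace Λ] {D : ℕ} {G : ℝ} {k : ℕ} {r E : ℝ}

theorem IsLocal.norm_bound_nonneg (hh : IsLocal k r E h) : 0 ≤ E :=
  (norm_nonneg _).trans (hh.norm_le ∅)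

theorem IsLocal.isSelfAdjoint_ham (hh : IsLocal k r E h) : IsSelfAdjoint (ham h) :=
  isSelfAdjoint_sum _ fun X _ => hh.isHermitian X

theorem card_termsMeeting_le (hΛ : IsLattice D G Λ) (hh : IsLocal k r E h) (S : Finset Λ) :
    (termsMeeting h S).card ≤ S.card * termBound D G r := by
  classical
  -- A nonzero term through `x` is a subset of the `r`-ball at `x`, hence the power of 2 in
  -- `termBound`.
  have hsub : termsMeeting h S ⊆ S.biUnion fun x => (ballAround {x} (max r 0)).powerset := by
    intro X hX
    simp only [termsMeeting, Finset.mem_filter, Finset.mem_univ, true_and] at hX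
    obtain ⟨h0, hX⟩ := hX
    obtain ⟨x, hxX, hxS⟩ := Finset.not_disjoint_iff.1 hX
    refine Finset.mem_biUnion.2 ⟨x, hxS, Finset.mem_powerset.2 fun y hy => ?_⟩
    simp only [ballAround, Finset.mem_filter, Finset.mem_univ, true_and]
    exact ⟨x, Finset.mem_singleton_self x, (hh.dist_le X h0 y hy x hxX).trans (le_max_left _ _)⟩
  refine (Finset.card_le_card hsub).trans (Finset.card_biUnion_le_card_mul _ _ _ fun x _ => ?_)
  rw [Finset.card_powerset, termBound]
  exact Nat.pow_le_pow_right two_pos (Nat.le_floor (card_ball_le hΛ x (le_max_right _ _)))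

theorem sum_termsMeeting_le (hΛ : IsLattice D G Λ) (hh : IsLocal k r E h) (S : Finset Λ)
    {f : Finset Λ → ℝ} {m : ℝ} (hm : 0 ≤ m) (hf : ∀ X ∈ termsMeeting h S, f X ≤ m) :
    ∑ X ∈ termsMeeting h S, f X ≤ S.card * termBound D G r * m := by
  refine (Finset.sum_le_card_nsmul _ _ m hf).trans ?_
  rw [nsmul_eq_mul]
  exact mul_le_mul_of_nonneg_right (by exact_mod_cast card_termsMeeting_le hΛ hh S) hm

/-- Only terms meeting `S` survive the inner commutator; each result involves at most `|S| + k`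
sites, and only terms meeting those survive the outer one. -/
theorem norm_lie_ham_lie_ham_le (hΛ : IsLattice D G Λ) (hh : IsLocal k r E h) {S : Finset Λ}
    {A : Op (Config Λ q)} (hA : SupportedOn S A) :
    ‖⁅ham h, ⁅ham h, A⁆⁆‖ ≤
      S.card * termBound D G r * ((S.card + k) * termBound D G r * (4 * E ^ 2 * ‖A‖)) := by
  have hE := hh.norm_bound_nonneg
  rw [lie_ham_eq_sum S A fun X hX => (hh.supportedOn X).commute hX hA, lie_sum_right]
  refine (norm_sum_le _ _).trans (sum_termsMeeting_le hΛ hh S (by positivity) fun X hX => ?_)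
  have h0 : h X ≠ 0 := by simp [termsMeeting] at hX; exact hX.1
  have hcard : ((S ∪ X).card : ℝ) ≤ S.card + k := by
    exact_mod_cast (Finset.card_union_le S X).trans (Nat.add_le_add_left (hh.card_le X h0) _)
  rw [lie_ham_eq_sum (S ∪ X)]
  · refine (norm_sum_le _ _).trans
      ((sum_termsMeeting_le hΛ hh _ (m := 4 * E ^ 2 * ‖A‖) (by positivity) fun Y _ => ?_).trans
        (by gcongr))
    calc ‖⁅h Y, ⁅h X, A⁆⁆‖ ≤ 2 * ‖h Y‖ * (2 * ‖h X‖ * ‖A‖) :=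
          (norm_lie_le _ _).trans (by gcongr; exact norm_lie_le _ _)
      _ ≤ 2 * E * (2 * E * ‖A‖) := by gcongr <;> exact hh.norm_le _
      _ = _ := by ring
  · intro Y hY
    rw [Finset.disjoint_union_right] at hY
    have h1 := (hh.supportedOn Y).commute hY.1 hA
    have h2 := (hh.supportedOn Y).commute hY.2 (hh.supportedOn X)
    rw [Ring.lie_def]
    exact (h2.mul_right h1).sub_right (h1.mul_right h2)

theorem lie_hamOn_ballAround (hh : IsLocal k r E h) {S : Finset Λ} {A : Op (Config Λ q)}
    (hA : SupportedOn S A) {d : ℝ} (hd : r ≤ d) : ⁅hamOn h (ballAround S d), A⁆ = ⁅ham h, A⁆ := by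
  rw [ham, hamOn, lie_sum_left, lie_sum_left]
  refine Finset.sum_subset (Finset.subset_univ _) fun X _ hX => ?_
  by_cases h0 : h X = 0
  · simp [h0, Ring.lie_def]
  refine ((hh.supportedOn X).commute ?_ hA).lie_eq
  refine Finset.disjoint_left.2 fun x hxX hxS => hX (Finset.mem_powerset.2 fun y hy => ?_)
  simp only [ballAround, Finset.mem_filter, Finset.mem_univ, true_and]
  exact ⟨x, hxS, (hh.dist_le X h0 y hy x hxX).trans hd⟩

/-- Linearization error with a ball that contains all interaction terms meeting `S`. -/
theorem linearizationError_le (hΛ : IsLattice D G Λ) (hh : IsLocal k r E h) {S : Finset Λ}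
    (hS : S.Nonempty) {A : Op (Config Λ q)} (hA : SupportedOn S A) {d : ℝ} (hd : r ≤ d) (t : ℝ) :
    linearizationError h S A d t ≤
      4 * (1 + k) * (termBound D G r * E) ^ 2 * (S.card : ℝ) ^ 2 * ‖A‖ * t ^ 2 := by
  rw [linearizationError, lie_hamOn_ballAround hh hA hd, evolve_eq_flow]
  refine (norm_flow_taylor hh.isSelfAdjoint_ham A t).trans ?_
  refine mul_le_mul_of_nonneg_right ((norm_lie_ham_lie_ham_le hΛ hh hA).trans ?_) (sq_nonneg t)
  have hV : (1 : ℝ) ≤ S.card := by exact_mod_cast hS.card_pos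
  have hk : (S.card + k : ℝ) ≤ (1 + k) * S.card := by
    nlinarith [mul_nonneg (Nat.cast_nonneg (α := ℝ) k) (sub_nonneg.2 hV)]
  calc _ ≤ S.card * termBound D G r *
        (((1 + k) * S.card) * termBound D G r * (4 * E ^ 2 * ‖A‖)) := by gcongr
    _ = _ := by ring

end

end Interaction

end LocalHam

/-! ### The Lieb–Robinson bound. -/

namespace LocalHam

open CStarFlow

section LiebRobinson

variable {Λ : Type} [Fintype Λ] [DecidableEq Λ] [MetricSpace Λ] {q : ℕ}
  {h : Finset Λ → Op (Config Λ q)} {D : ℕ} {G : ℝ} {k : ℕ} {r E : ℝ}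

/-- The commutator `[A, B(-t)]`, in the interaction picture of the part of the Hamiltonian that
does not meet `S`. -/
noncomputable def interactionLie (h : Finset Λ → Op (Config Λ q)) (S : Finset Λ)
    (A B : Op (Config Λ q)) (t : ℝ) : Op (Config Λ q) :=
  flow (ham h - ∑ X ∈ termsMeeting h S, h X) ⁅A, flow (ham h) B (-t)⁆ t

theorem norm_interactionLie (hh : IsLocal k r E h) (S : Finset Λ) (A B : Op (Config Λ q)) (t : ℝ) :
    ‖interactionLie h S A B t‖ = ‖⁅A, flow (ham h) B (-t)⁆‖ :=
  norm_flow (hh.isSelfAdjoint_ham.sub (isSelfAdjoint_sum _ fun X _ => hh.isHermitian X)) _ _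

/-- Leaving `m` free serves both uses: the Grönwall argument for the terms and the final integration
for a general observable. -/
theorem exists_hasDerivAt_interactionLie (hΛ : IsLattice D G Λ) (hh : IsLocal k r E h)
    {S : Finset Λ} {A : Op (Config Λ q)} (hA : SupportedOn S A) (B : Op (Config Λ q)) (t : ℝ) :
    ∃ P' : Op (Config Λ q), HasDerivAt (interactionLie h S A B) P' t ∧
      ∀ m : ℝ, 0 ≤ m → (∀ X ∈ termsMeeting h S, ‖⁅h X, flow (ham h) B (-t)⁆‖ ≤ m) →
        ‖P'‖ ≤ 2 * ‖A‖ * (S.card * termBound D G r * m) := by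
  refine ⟨_, hasDerivAt_interaction (commute_ham_sub_sum S A fun X hX =>
    (hh.supportedOn X).commute hX hA) B t, fun m hm hX => ?_⟩
  rw [norm_flow (hh.isSelfAdjoint_ham.sub (isSelfAdjoint_sum _ fun X _ => hh.isHermitian X)),
    norm_neg, norm_smul, Complex.norm_I, one_mul, sub_sub_cancel, lie_sum_left]
  refine (norm_lie_le _ _).trans (mul_le_mul_of_nonneg_left ?_ (by positivity))
  exact (norm_sum_le _ _).trans (sum_termsMeeting_le hΛ hh S hm hX)

/-- Velocity in the Lieb-Robinson bound. -/
noncomputable def velocity (D : ℕ) (G : ℝ) (k : ℕ) (r E : ℝ) : ℝ :=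
  -- The factor `e^{2r}` is the change of weight between overlapping terms. The `+ 1` makes the
  -- velocity at least 1, as the final integration and `le_radius` require.
  2 * |E| * (k * termBound D G r) * Real.exp (2 * r) + 1

theorem one_le_velocity (D : ℕ) (G : ℝ) (k : ℕ) (r E : ℝ) : 1 ≤ velocity D G k r E := by
  have : 0 ≤ 2 * |E| * (k * termBound D G r) * Real.exp (2 * r) := by positivity
  rw [velocity]; linarith

theorem velocity_pos (D : ℕ) (G : ℝ) (k : ℕ) (r E : ℝ) : 0 < velocity D G k r E :=
  one_pos.trans_le (one_le_velocity D G k r E)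

/-- Lieb-Robinson bound for the interaction terms themselves. -/
theorem norm_lie_term_flow_le (hΛ : IsLattice D G Λ) (hh : IsLocal k r E h) {T : Finset Λ}
    {B : Op (Config Λ q)} (hB : SupportedOn T B) {t : ℝ} (ht : 0 ≤ t)
    {X : Finset Λ} {x : Λ} (hx : x ∈ X) :
    ‖⁅h X, flow (ham h) B (-t)⁆‖ ≤ 2 * E * ‖B‖ *
      Real.exp (2 * r - Metric.infDist x T + velocity D G k r E * t) := by
  have hE := hh.norm_bound_nonneg
  by_cases h0 : h X = 0
  · rw [h0, Ring.lie_def]; simp only [zero_mul, mul_zero, sub_zero, norm_zero]; positivity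
  obtain ⟨pt, hpt⟩ : ∃ pt : Finset Λ → Λ, ∀ X : Finset Λ, X.Nonempty → pt X ∈ X :=
    ⟨fun X => if hX : X.Nonempty then hX.choose else x, fun X hX => by
      simpa [hX] using hX.choose_spec⟩
  -- Representatives of overlapping terms are at most `2r` apart, so in the sup norm the weighted
  -- family satisfies the closed inequality `‖F'‖ ≤ v ‖F‖`.
  set δ : Finset Λ → ℝ := fun X => Metric.infDist (pt X) (T : Set Λ) with hδ
  set F : ℝ → Finset Λ → Op (Config Λ q) := fun s X =>
    Real.exp (δ X) • interactionLie h X (h X) B s with hF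
  have hnF : ∀ s X, ‖F s X‖ = Real.exp (δ X) * ‖⁅h X, flow (ham h) B (-s)⁆‖ := fun s X => by
    rw [hF]
    simp only [norm_smul, Real.norm_eq_abs, Real.abs_exp, norm_interactionLie hh]
  have hterm : ∀ s Y, ‖⁅h Y, flow (ham h) B (-s)⁆‖ ≤ Real.exp (-δ Y) * ‖F s‖ := fun s Y => by
    have := (hnF s Y) ▸ norm_le_pi_norm (F s) Y
    calc _ = Real.exp (-δ Y) * (Real.exp (δ Y) * ‖⁅h Y, flow (ham h) B (-s)⁆‖) := by
          rw [← mul_assoc, ← Real.exp_add]; simp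
      _ ≤ _ := by gcongr
  have hderiv : ∀ s, ∃ F' : Finset Λ → Op (Config Λ q), HasDerivAt F F' s ∧
      ‖F'‖ ≤ velocity D G k r E * ‖F s‖ := fun s => by
    choose P hP hPle using fun Y : Finset Λ =>
      exists_hasDerivAt_interactionLie hΛ hh (hh.supportedOn Y) B s
    refine ⟨fun Y => Real.exp (δ Y) • P Y, hasDerivAt_pi.2 fun Y =>
      (hP Y).const_smul (Real.exp (δ Y)), ?_⟩
    refine (pi_norm_le_iff_of_nonneg
      (mul_nonneg (velocity_pos D G k r E).le (norm_nonneg _))).2 fun Y => ?_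
    rw [norm_smul, Real.norm_eq_abs, Real.abs_exp]
    -- Size and diameter are controlled only for nonzero terms; for a zero term any finite `m` shows
    -- that the derivative vanishes.
    by_cases hY0 : h Y = 0
    · have hle := hPle Y (∑ Z, ‖⁅h Z, flow (ham h) B (-s)⁆‖)
        (Finset.sum_nonneg fun _ _ => norm_nonneg _) fun Z _ =>
          Finset.single_le_sum (f := fun Z => ‖⁅h Z, flow (ham h) B (-s)⁆‖)
            (fun _ _ => norm_nonneg _) (Finset.mem_univ Z)
      rw [hY0, norm_zero, mul_zero, zero_mul] at hle
      rw [le_antisymm hle (norm_nonneg _), mul_zero]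
      exact mul_nonneg (velocity_pos D G k r E).le (norm_nonneg _)
    have hle := hPle Y (Real.exp (2 * r - δ Y) * ‖F s‖) (by positivity) fun Z hZ => by
      simp only [termsMeeting, Finset.mem_filter, Finset.mem_univ, true_and] at hZ
      refine (hterm s Z).trans (mul_le_mul_of_nonneg_right (Real.exp_le_exp.2 ?_) (norm_nonneg _))
      obtain ⟨y, hyZ, hyY⟩ := Finset.not_disjoint_iff.1 hZ.2
      have h1 := hh.dist_le Y hY0 _ (hpt Y ⟨y, hyY⟩) y hyY
      have h2 := hh.dist_le Z hZ.1 y hyZ _ (hpt Z ⟨y, hyZ⟩)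
      have h3 : δ Y ≤ δ Z + dist (pt Y) (pt Z) := Metric.infDist_le_infDist_add_dist
      have h4 := dist_triangle (pt Y) y (pt Z)
      linarith
    calc Real.exp (δ Y) * ‖P Y‖
        ≤ Real.exp (δ Y) * (2 * E * (k * termBound D G r * (Real.exp (2 * r - δ Y) * ‖F s‖))) := by
          gcongr
          refine hle.trans ?_
          gcongr
          · exact hh.norm_le Y
          · exact_mod_cast hh.card_le Y hY0
      _ = 2 * |E| * (k * termBound D G r) * Real.exp (2 * r) * ‖F s‖ := by
          rw [abs_of_nonneg hE, Real.exp_sub]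
          field_simp
      _ ≤ velocity D G k r E * ‖F s‖ := by
          gcongr
          rw [velocity]; linarith
  choose F' hF' hF'le using hderiv
  have hinit : ‖F 0‖ ≤ Real.exp r * (2 * E * ‖B‖) := by
    refine (pi_norm_le_iff_of_nonneg (by positivity)).2 fun Y => ?_
    rw [hnF, neg_zero, flow_zero]
    -- Initially only terms touching `T` contribute, and their weight is at most `e^r`.
    by_cases hY : h Y = 0 ∨ Disjoint Y T
    · have : ⁅h Y, B⁆ = 0 := by
        rcases hY with hY | hY
        · simp [hY, Ring.lie_def]
        · exact ((hh.supportedOn Y).commute hY hB).lie_eq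
      rw [this, norm_zero, mul_zero]; positivity
    · push Not at hY
      obtain ⟨y, hyY, hyT⟩ := Finset.not_disjoint_iff.1 hY.2
      have h1 : δ Y ≤ dist (pt Y) y := Metric.infDist_le_dist_of_mem (by simpa using hyT)
      have h2 := hh.dist_le Y hY.1 _ (hpt Y ⟨y, hyY⟩) y hyY
      gcongr
      · exact h1.trans h2
      · refine (norm_lie_le _ _).trans ?_
        gcongr
        exact hh.norm_le Y
  have hgron := norm_le_gronwallBound_of_norm_deriv_right_le (a := 0) (b := t)
    (fun s _ => (hF' s).continuousAt.continuousWithinAt) (fun s _ => (hF' s).hasDerivWithinAt)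
    hinit (fun s _ => (hF'le s).trans_eq (add_zero _).symm) t ⟨ht, le_rfl⟩
  rw [gronwallBound_ε0, sub_zero] at hgron
  have hδx : Metric.infDist x (T : Set Λ) - r ≤ δ X := by
    have h1 : Metric.infDist x (T : Set Λ) ≤ δ X + dist x (pt X) :=
      Metric.infDist_le_infDist_add_dist
    have h2 := hh.dist_le X h0 x hx _ (hpt X ⟨x, hx⟩)
    linarith
  calc _ ≤ Real.exp (-δ X) *
        (Real.exp r * (2 * E * ‖B‖) * Real.exp (velocity D G k r E * t)) :=
        (hterm t X).trans (by gcongr)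
    _ = 2 * E * ‖B‖ * Real.exp (r - δ X + velocity D G k r E * t) := by
        rw [Real.exp_add, Real.exp_sub, Real.exp_neg]; ring
    _ ≤ _ := mul_le_mul_of_nonneg_left (Real.exp_le_exp.2 (by linarith)) (by positivity)

/-- Lieb-Robinson bound for observables at positive distance. -/
theorem norm_lie_flow_le_of_pos (hΛ : IsLattice D G Λ) (hh : IsLocal k r E h) {S T : Finset Λ}
    {A B : Op (Config Λ q)} (hA : SupportedOn S A) (hB : SupportedOn T B) {d : ℝ} (hd : 0 < d)
    (hST : ∀ x ∈ S, ∀ y ∈ T, d ≤ dist x y) {t : ℝ} (ht : 0 ≤ t) :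
    ‖⁅B, flow (ham h) A t⁆‖ ≤
      4 * termBound D G r * E * Real.exp (2 * r) * S.card * ‖A‖ * ‖B‖ *
        Real.exp (-(d - velocity D G k r E * t)) := by
  have hE := hh.norm_bound_nonneg
  -- `Metric.infDist` to the empty set is 0, so the distance bound below needs `T` nonempty.
  rcases T.eq_empty_or_nonempty with rfl | hT
  · rw [hB.lie_eq_zero_of_empty, norm_zero]
    positivity
  have hdisj : Disjoint S T := Finset.disjoint_left.2 fun x hxS hxT => by
    have := hST x hxS x hxT
    rw [dist_self] at this
    linarith
  choose P hP hPle using fun s : ℝ => exists_hasDerivAt_interactionLie hΛ hh hA B s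
  set v := velocity D G k r E with hv
  have hv1 : 1 ≤ v := one_le_velocity D G k r E
  set C := 4 * termBound D G r * E * Real.exp (2 * r) * S.card * ‖A‖ * ‖B‖ * Real.exp (-d) with hC
  have hC0 : 0 ≤ C := by positivity
  rw [norm_lie_flow hh.isSelfAdjoint_ham, ← norm_interactionLie hh S]
  have key := image_norm_le_of_norm_deriv_right_le_deriv_boundary (a := 0) (b := t)
    (f := interactionLie h S A B)
    (B := fun s => C * Real.exp (v * s)) (B' := fun s => C * (Real.exp (v * s) * v))
    (fun s _ => (hP s).continuousAt.continuousWithinAt) (fun s _ => (hP s).hasDerivWithinAt)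
    (by
      rw [norm_interactionLie hh, neg_zero, flow_zero, (hA.commute hdisj hB).lie_eq, norm_zero]
      positivity)
    (fun s => by
      simpa using (((hasDerivAt_id s).const_mul v).exp).const_mul C)
    (fun s hs => by
      have hle := hPle s (2 * E * ‖B‖ * Real.exp (2 * r - d + v * s)) (by positivity) fun X hX => by
        simp only [termsMeeting, Finset.mem_filter, Finset.mem_univ, true_and] at hX
        obtain ⟨x, hxX, hxS⟩ := Finset.not_disjoint_iff.1 hX.2
        refine (norm_lie_term_flow_le hΛ hh hB hs.1 hxX).trans ?_
        have : d ≤ Metric.infDist x (T : Set Λ) :=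
          (Metric.le_infDist (by simpa using hT)).2 fun {y} hy => hST x hxS y (by simpa using hy)
        gcongr
      calc ‖P s‖ ≤ C * Real.exp (v * s) := by
            refine hle.trans_eq ?_
            rw [hC, Real.exp_add, Real.exp_sub, Real.exp_neg]
            ring
        -- Since `v ≥ 1`, the comparison function `C e^{vs}` grows at least as fast as required.
        _ ≤ C * (Real.exp (v * s) * v) := by
            have := mul_nonneg hC0 (Real.exp_pos (v * s)).le
            nlinarith)
    ⟨ht, le_rfl⟩
  refine key.trans_eq ?_
  rw [hC, neg_sub, sub_eq_add_neg, add_comm, Real.exp_add]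
  ring

end LiebRobinson

theorem liebRobinson_velocity (D : ℕ) (G : ℝ) (k : ℕ) (r E : ℝ) {c : ℝ}
    (hc : 4 * termBound D G r * |E| * Real.exp (2 * r) + 2 ≤ c) :
    LiebRobinson D G k r E c (velocity D G k r E) 1 := by
  intro Λ _ _ _ hΛ q h hh S T A B hA hB d hST t ht
  rw [evolve_eq_flow, div_one]
  have hc0 : 0 ≤ 4 * termBound D G r * |E| * Real.exp (2 * r) := by positivity
  rcases lt_or_ge 0 d with hd | hd
  · refine (norm_lie_flow_le_of_pos hΛ hh hA hB hd hST ht).trans ?_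
    gcongr
    rw [abs_of_nonneg hh.norm_bound_nonneg] at hc
    linarith
  -- For `d ≤ 0` the exponential is at least 1, so the trivial bound `2 ‖A‖ ‖B‖` suffices; hence the
  -- `+ 2` in the condition on `c`.
  rcases S.eq_empty_or_nonempty with rfl | hS
  · rw [norm_lie_flow hh.isSelfAdjoint_ham, hA.lie_eq_zero_of_empty]
    simp
  have hV : (1 : ℝ) ≤ S.card := by exact_mod_cast hS.card_pos
  have hexp : 1 ≤ Real.exp (-(d - velocity D G k r E * t)) := by
    rw [Real.one_le_exp_iff]
    have := mul_nonneg (velocity_pos D G k r E).le ht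
    linarith
  calc ‖⁅B, flow (ham h) A t⁆‖ ≤ 2 * ‖B‖ * ‖A‖ := by
        simpa [norm_flow hh.isSelfAdjoint_ham] using norm_lie_le B (flow (ham h) A t)
    _ = 2 * 1 * ‖A‖ * ‖B‖ * 1 := by ring
    _ ≤ c * S.card * ‖A‖ * ‖B‖ * Real.exp (-(d - velocity D G k r E * t)) := by
        have hc2 : 2 ≤ c := by linarith
        gcongr

/-! ### Lower bound on the radius, and choice of constants. -/

theorem le_radius {c v c' ρ : ℝ} {V : ℕ} {t : ℝ} (hv : 1 ≤ v) (hc' : 0 < c') (hV : 1 ≤ V)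
    (ht : 0 < t) (hc : c' * Real.exp ρ ≤ c) : ρ ≤ radius c v c' V t := by
  have hV' : (1 : ℝ) ≤ V := by exact_mod_cast hV
  have h1 : Real.exp ρ / t ≤ c * V / (c' * t) := by
    rw [div_le_div_iff₀ ht (by positivity)]
    have hc0 : 0 ≤ c := (by positivity : 0 ≤ c' * Real.exp ρ).trans hc
    have h2 : c' * Real.exp ρ ≤ c * V := hc.trans (le_mul_of_one_le_right hc0 hV')
    nlinarith
  have h2 : ρ - Real.log t ≤ Real.log (c * V / (c' * t)) := by
    rw [← Real.log_exp ρ, ← Real.log_div (Real.exp_pos ρ).ne' ht.ne']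
    exact Real.log_le_log (by positivity) h1
  -- For large `t` the logarithm may be negative, but `log t ≤ t - 1` and `v ≥ 1` let `v t` absorb
  -- the loss.
  have h3 := Real.log_le_sub_one_of_pos ht
  have h4 : t ≤ v * t := le_mul_of_one_le_left ht.le hv
  rw [radius]; linarith

theorem card_le_of_dist_le {Λ : Type} [Fintype Λ] [MetricSpace Λ] {D : ℕ} {G : ℝ}
    (hΛ : IsLattice D G Λ) {S : Finset Λ} (hS : S.Nonempty) {ρ : ℝ} (hρ : 0 ≤ ρ)
    (hdist : ∀ x ∈ S, ∀ y ∈ S, dist x y ≤ ρ) : (S.card : ℝ) ≤ G * (1 + ρ) ^ D := by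
  obtain ⟨x, hx⟩ := hS
  refine le_trans ?_ (card_ball_le hΛ x hρ)
  exact_mod_cast Finset.card_le_card fun y hy => by
    simpa [ballAround] using hdist y hy x hx

end LocalHam

open LocalHam in
theorem mainTheorem5 (D : ℕ) (G : ℝ) (k : ℕ) (r E : ℝ) :
    ∃ c v ξ c' : ℝ, 0 < c ∧ 0 < v ∧ 0 < ξ ∧ 0 < c' ∧
      LocalHam.LiebRobinson D G k r E c v ξ ∧
      LocalHam.TaylorConstant c' ∧
      (∀ V₀ : ℕ, ∃ κ : ℝ, 0 < κ ∧
          ∀ (Λ : Type) [Fintype Λ] [DecidableEq Λ] [MetricSpace Λ], LocalHam.IsLattice D G Λ →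
          ∀ (q : ℕ) (h : Finset Λ → LocalHam.Op (LocalHam.Config Λ q)),
            LocalHam.IsLocal k r E h →
          ∀ (S : Finset Λ) (A : LocalHam.Op (LocalHam.Config Λ q)),
            S.Nonempty → LocalHam.SupportedOn S A →
          ∀ t : ℝ, 0 < t → S.card ≤ V₀ →
          ∀ d : ℝ, LocalHam.radius c v c' S.card t ≤ d →
            LocalHam.linearizationError h S A d t ≤
              κ * ‖A‖ * LocalHam.radius c v c' S.card t ^ 2 * t ^ 2) ∧
      (∃ κ : ℝ, 0 < κ ∧
          ∀ (Λ : Type) [Fintype Λ] [DecidableEq Λ] [MetricSpace Λ], LocalHam.IsLattice D G Λ →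
          ∀ (q : ℕ) (h : Finset Λ → LocalHam.Op (LocalHam.Config Λ q)),
            LocalHam.IsLocal k r E h →
          ∀ (S : Finset Λ) (A : LocalHam.Op (LocalHam.Config Λ q)),
            S.Nonempty → LocalHam.SupportedOn S A →
          ∀ t : ℝ, 0 < t → (∀ x ∈ S, ∀ y ∈ S, dist x y ≤ LocalHam.radius c v c' S.card t) →
          ∀ d : ℝ, LocalHam.radius c v c' S.card t ≤ d →
            LocalHam.linearizationError h S A d t ≤
              κ * ‖A‖ * LocalHam.radius c v c' S.card t ^ (2 * D) * t ^ 2) := by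
  set c' : ℝ := 4 with hc'
  set ρ : ℝ := max 1 r with hρ
  -- The first two summands serve Lieb–Robinson; the last forces the radius above `ρ`. The absolute
  -- value is needed because `0 ≤ E` is known only once a system is given.
  set c : ℝ := 4 * termBound D G r * |E| * Real.exp (2 * r) + 2 + c' * Real.exp ρ with hc
  have hcpos : 0 < c := by positivity
  have hv := one_le_velocity D G k r E
  have hrad : ∀ V : ℕ, 1 ≤ V → ∀ t : ℝ, 0 < t → ρ ≤ radius c (velocity D G k r E) c' V t :=
    fun V hV t ht => le_radius hv (by positivity) hV ht (by
      rw [hc]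
      have : 0 ≤ 4 * termBound D G r * |E| * Real.exp (2 * r) + 2 := by positivity
      linarith)
  set M : ℝ := 4 * (1 + k) * (termBound D G r * E) ^ 2 with hM
  have hM0 : 0 ≤ M := by positivity
  refine ⟨c, velocity D G k r E, 1, c', hcpos, velocity_pos D G k r E, one_pos, by positivity,
    liebRobinson_velocity D G k r E ?_, taylorConstant_four, fun V₀ => ?_, ?_⟩
  · rw [hc]
    have : 0 ≤ c' * Real.exp ρ := by positivity
    linarith
  -- The `+ 1` keeps `κ` positive even when `M` or `V₀` vanishes.
  · refine ⟨M * (V₀ : ℝ) ^ 2 + 1, by positivity, ?_⟩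
    intro Λ _ _ _ hΛ q h hh S A hS hA t ht hV d hd
    have hr := hrad S.card hS.card_pos t ht
    set R := radius c (velocity D G k r E) c' S.card t
    have hR1 : 1 ≤ R := (le_max_left _ _).trans hr
    refine (linearizationError_le hΛ hh hS hA ((le_max_right 1 r).trans (hr.trans hd)) t).trans ?_
    have hV' : (S.card : ℝ) ≤ V₀ := by exact_mod_cast hV
    calc M * (S.card : ℝ) ^ 2 * ‖A‖ * t ^ 2 ≤ (M * (V₀ : ℝ) ^ 2 + 1) * ‖A‖ * 1 * t ^ 2 := by
          rw [mul_one]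
          gcongr
          calc M * (S.card : ℝ) ^ 2 ≤ M * (V₀ : ℝ) ^ 2 := by gcongr
            _ ≤ _ := by linarith
      _ ≤ _ := by
          gcongr
          exact one_le_pow₀ hR1
  · refine ⟨M * (G * 2 ^ D) ^ 2 + 1, by positivity, ?_⟩
    intro Λ _ _ _ hΛ q h hh S A hS hA t ht hdiam d hd
    have hr := hrad S.card hS.card_pos t ht
    set R := radius c (velocity D G k r E) c' S.card t
    have hR1 : 1 ≤ R := (le_max_left _ _).trans hr
    have hR0 : 0 ≤ R := zero_le_one.trans hR1
    refine (linearizationError_le hΛ hh hS hA ((le_max_right 1 r).trans (hr.trans hd)) t).trans ?_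
    have hcard := card_le_of_dist_le hΛ hS hR0 hdiam
    have hG : 0 ≤ G := by
      have h1 : 0 < G * (1 + R) ^ D :=
        (Nat.cast_pos.2 hS.card_pos).trans_le hcard
      exact (pos_of_mul_pos_left h1 (by positivity)).le
    -- Uses `1 + R ≤ 2R`, valid because `R ≥ 1`.
    have hcard2 : (S.card : ℝ) ≤ G * 2 ^ D * R ^ D := by
      refine hcard.trans ?_
      rw [mul_assoc, ← mul_pow]
      gcongr
      linarith
    calc M * (S.card : ℝ) ^ 2 * ‖A‖ * t ^ 2 ≤ M * (G * 2 ^ D * R ^ D) ^ 2 * ‖A‖ * t ^ 2 := by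
          gcongr
      _ = M * (G * 2 ^ D) ^ 2 * ‖A‖ * R ^ (2 * D) * t ^ 2 := by
          rw [mul_pow _ (R ^ D), ← pow_mul R, mul_comm D 2]; ring
      _ ≤ _ := by
          gcongr
          linarith
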